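/- Let $(x_i,y_i)$, $i=1,\dots,n$, be data with $x_i=(x_{i1},\dots,x_{ip})\in\mathbb{R}^p$ and $y=(y_1,\dots,y_n)^\top\in\mathbb{R}^n$. For a feature $j\in\{1,\dots,p\}$ and a smoothness parameter $\lambda\ge 0$, a cubic smoothing spline fitted to responses $r\in\mathbb{R}^n$ is a twice differentiable function $g:\mathbb{R}\to\mathbb{R}$ that minimizes $$\sum_{i=1}^n \bigl(r_i-g(x_{ij})\bigr)^2+\lambda\int_{\mathbb{R}} g''(t)^2\,dt$$ among all twice differentiable functions. Let $d$ base learners be given, the $m$-th being the cubic smoothing spline in feature $j_m$ with parameter $\lambda_m\ge 0$, and assume that for each $m$ the values $x_{1j_m},\dots,x_{nj_m}$ are pairwise distinct. Let $\nu\in(0,1]$ be a step size and $f^{[0]}:\mathbb{R}^p\to\mathbb{R}$ an arbitrary initial function. Component-wise $L_2$-boosting selects in each step $k\ge 1$ a base learner $m_k\in\{1,\dots,d\}$, fits it to the current residuals $r_i=y_i-f^{[k-1]}(x_i)$ to obtain a cubic smoothing spline $g_k$, and sets $f^{[k]}(x)=f^{[k-1]}(x)+\nu\, g_k(x_{j_{m_k}})$.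 Then, for every sequence of selections $(m_k)_{k\ge1}$ (in particular under greedy, cyclic or random selection), the fitted values converge to those of the saturated model (perfect fit) $f^\ast=y$: $$\bigl(f^{[k]}(x_1),\dots,f^{[k]}(x_n)\bigr)^\top\longrightarrow y\qquad(k\to\infty).$$ -/

import Mathlib

open Filter Topology
open scoped ENNReal

namespace CSSBoosting

/-- `g : ℝ → ℝ` is twice differentiable (everywhere). -/
def TwiceDifferentiable (g : ℝ → ℝ) : Prop :=
  Differentiable ℝ g ∧ Differentiable ℝ (deriv g)

/-- The roughness penalty `∫ (g'')²` over the real line, as an extended nonnegative number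
(it is `∞` exactly when `g''` is not square integrable). -/
noncomputable def roughness (g : ℝ → ℝ) : ℝ≥0∞ :=
  ∫⁻ t, ENNReal.ofReal ((deriv (deriv g) t) ^ 2)

/-- The penalized least squares criterion `∑ i, (r i - g (x i))² + lam * ∫ (g'')²` for design
points `x`, responses `r` and smoothness parameter `lam ≥ 0`. -/
noncomputable def criterion {n : ℕ} (lam : ℝ) (x r : Fin n → ℝ) (g : ℝ → ℝ) : ℝ≥0∞ :=
  ENNReal.ofReal (∑ i, (r i - g (x i)) ^ 2) + ENNReal.ofReal lam * roughness g

/-- `g` is a cubic smoothing spline for the data `(x i, r i)`: it minimizes the penalized least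
squares criterion among all twice differentiable functions. -/
def IsCubicSmoothingSpline {n : ℕ} (lam : ℝ) (x r : Fin n → ℝ) (g : ℝ → ℝ) : Prop :=
  TwiceDifferentiable g ∧
    ∀ h : ℝ → ℝ, TwiceDifferentiable h → criterion lam x r g ≤ criterion lam x r h

/-- `f 0, f 1, f 2, …` are iterates of component-wise `L₂`-boosting with step size `ν` for the
data `(X i, y i)`. Base learner `m` is the cubic smoothing spline in the feature `feat m` with
smoothness parameter `lam m`. In the step from `f k` to `f (k + 1)` the base learner `sel k` is
fitted to the current residuals `y i - f k (X i)` (the negative gradient of the `L₂` loss), and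
`ν` times the fit is added. The initial function `f 0` is arbitrary. -/
def IsBoostingRun {n p d : ℕ} (X : Matrix (Fin n) (Fin p) ℝ) (y : Fin n → ℝ)
    (feat : Fin d → Fin p) (lam : Fin d → ℝ) (ν : ℝ) (sel : ℕ → Fin d)
    (f : ℕ → (Fin p → ℝ) → ℝ) : Prop :=
  ∀ k : ℕ, ∃ g : ℝ → ℝ,
    IsCubicSmoothingSpline (lam (sel k)) (fun i => X i (feat (sel k)))
      (fun i => y i - f k (X i)) g ∧
    ∀ u : Fin p → ℝ, f (k + 1) u = f k u + ν * g (u (feat (sel k)))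

end CSSBoosting

namespace CSSBoosting

/-! Neither an explicit form nor linearity of the spline is needed, only minimality. Comparing the
fit with an interpolant of `t * r`, whose roughness is at most `C * t ^ 2 * ∑ i, r i ^ 2`, shows
that one fit contracts the residual sum of squares by a factor independent of `r`
(`exists_rss_contraction`). Convexity carries this over to steps damped by `ν`
(`rss_damped_step_le`). With finitely many learners the worst factor is still below 1, so the decay
is geometric for every selection. -/

/-- At pairwise distinct points there are smooth compactly supported cardinal functions. -/
theorem exists_cardinal_bumps {n : ℕ} {x : Fin n → ℝ} (hx : Function.Injective x) :
    ∃ φ : Fin n → ℝ → ℝ, (∀ i, ContDiff ℝ 2 (φ i)) ∧ (∀ i, HasCompactSupport (φ i)) ∧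
      ∀ i j, φ i (x j) = if i = j then 1 else 0 := by
  have key : ∀ i, ∃ f : ℝ → ℝ, ContDiff ℝ 2 f ∧ HasCompactSupport f ∧
      ∀ j, f (x j) = if i = j then 1 else 0 := by
    intro i
    have hs : (x '' {j | j ≠ i})ᶜ ∈ 𝓝 (x i) := by
      refine (Set.toFinite _).isClosed.isOpen_compl.mem_nhds ?_
      rintro ⟨j, hj, hji⟩
      exact hj (hx hji)
    obtain ⟨f, hf, hc, hd, -, h1⟩ := exists_contDiff_tsupport_subset (n := 2) hs
    refine ⟨f, hd, hc, fun j => ?_⟩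
    split_ifs with h
    · rw [← h, h1]
    · by_contra h0
      exact hf (subset_tsupport f h0) ⟨j, fun e => h e.symm, rfl⟩
  choose φ h1 h2 h3 using key
  exact ⟨φ, h1, h2, h3⟩

theorem deriv_deriv_sum_const_mul {n : ℕ} {φ : Fin n → ℝ → ℝ} (hφ : ∀ i, ContDiff ℝ 2 (φ i))
    (a : Fin n → ℝ) :
    TwiceDifferentiable (fun s => ∑ i, a i * φ i s) ∧
      deriv (deriv fun s => ∑ i, a i * φ i s) = fun s => ∑ i, a i * deriv (deriv (φ i)) s := by
  have hd : ∀ i, Differentiable ℝ (φ i) := fun i => (hφ i).differentiable (by norm_num)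
  have hd' : ∀ i, Differentiable ℝ (deriv (φ i)) := fun i =>
    (hφ i).differentiable_deriv_two
  have h1 : deriv (fun s => ∑ i, a i * φ i s) = fun s => ∑ i, a i * deriv (φ i) s := by
    funext s
    exact (HasDerivAt.fun_sum fun i _ => ((hd i s).hasDerivAt.const_mul (a i))).deriv
  refine ⟨⟨by fun_prop, ?_⟩, ?_⟩
  · rw [h1]
    fun_prop
  · rw [h1]
    funext s
    exact (HasDerivAt.fun_sum fun i _ => ((hd' i s).hasDerivAt.const_mul (a i))).deriv

/-- Any responses at pairwise distinct points are interpolated by a twice differentiable function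
whose roughness is at most a constant times the squared norm of the responses. -/
theorem exists_interpolant {n : ℕ} {x : Fin n → ℝ} (hx : Function.Injective x) :
    ∃ C : ℝ, 0 ≤ C ∧ ∀ r : Fin n → ℝ, ∃ h : ℝ → ℝ, TwiceDifferentiable h ∧
      (∀ i, h (x i) = r i) ∧ roughness h ≤ ENNReal.ofReal (C * ∑ i, r i ^ 2) := by
  obtain ⟨φ, hφ, hc, hval⟩ := exists_cardinal_bumps hx
  -- By Cauchy–Schwarz, `(∑ i, r i * φ i'')² ≤ (∑ i, r i ^ 2) * B` pointwise, so `C = ∫ B` serves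
  -- all `r` at once.
  set B : ℝ → ℝ := fun s => ∑ i, deriv (deriv (φ i)) s ^ 2 with hB
  have hB0 : ∀ s, 0 ≤ B s := fun s => Finset.sum_nonneg fun i _ => sq_nonneg _
  have hBi : MeasureTheory.Integrable B := by
    refine MeasureTheory.integrable_finsetSum _ fun i _ => ?_
    have hcont : Continuous (deriv (deriv (φ i))) := by
      have := (hφ i).continuous_iteratedDeriv 2 le_rfl
      rwa [iteratedDeriv_succ, iteratedDeriv_one] at this
    have hsupp : HasCompactSupport (deriv (deriv (φ i))) := (hc i).deriv.deriv
    have hsq : HasCompactSupport fun s => deriv (deriv (φ i)) s ^ 2 :=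
      hsupp.mono fun s hs => (pow_ne_zero_iff two_ne_zero).1 hs
    exact (hcont.pow 2).integrable_of_hasCompactSupport hsq
  refine ⟨∫ s, B s, MeasureTheory.integral_nonneg hB0, fun r => ?_⟩
  obtain ⟨htd, hdd⟩ := deriv_deriv_sum_const_mul hφ r
  refine ⟨_, htd, fun i => by simp [hval], ?_⟩
  calc roughness (fun s => ∑ i, r i * φ i s)
      ≤ ∫⁻ s, ENNReal.ofReal ((∑ i, r i ^ 2) * B s) := by
        unfold roughness
        rw [hdd]
        exact MeasureTheory.lintegral_mono fun s =>
          ENNReal.ofReal_le_ofReal (Finset.sum_mul_sq_le_sq_mul_sq _ _ _)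
    _ = ENNReal.ofReal (∫ s, (∑ i, r i ^ 2) * B s) :=
        (MeasureTheory.ofReal_integral_eq_lintegral_ofReal (hBi.const_mul _)
          (Eventually.of_forall fun s =>
            mul_nonneg (Finset.sum_nonneg fun i _ => sq_nonneg _) (hB0 s))).symm
    _ = ENNReal.ofReal ((∫ s, B s) * ∑ i, r i ^ 2) := by
        rw [MeasureTheory.integral_const_mul, mul_comm]

/-- A cubic smoothing spline reduces the residual sum of squares by a fixed factor. -/
theorem exists_rss_contraction {n : ℕ} {x : Fin n → ℝ} (hx : Function.Injective x) {lam : ℝ}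
    (hlam : 0 ≤ lam) :
    ∃ c : ℝ, 0 < c ∧ c ≤ 1 ∧ ∀ (r : Fin n → ℝ) (g : ℝ → ℝ),
      IsCubicSmoothingSpline lam x r g →
        ∑ i, (r i - g (x i)) ^ 2 ≤ (1 - c) * ∑ i, r i ^ 2 := by
  obtain ⟨C, hC, hint⟩ := exists_interpolant hx
  have hK : 0 ≤ lam * C := mul_nonneg hlam hC
  -- This value of `t` minimizes `(1 - t) ^ 2 + lam * C * t ^ 2`, and the minimum is `1 - t`.
  refine ⟨(1 + lam * C)⁻¹, by positivity, inv_le_one_of_one_le₀ (by linarith),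
    fun r g hg => ?_⟩
  set t : ℝ := (1 + lam * C)⁻¹ with ht
  have ht1 : t * (1 + lam * C) = 1 := inv_mul_cancel₀ (by positivity)
  have hS : 0 ≤ ∑ i, r i ^ 2 := Finset.sum_nonneg fun i _ => sq_nonneg _
  have ht0 : t ≤ 1 := inv_le_one_of_one_le₀ (by linarith)
  obtain ⟨h, hh, hhx, hR⟩ := hint fun i => t * r i
  have hsum : ∑ i, (t * r i) ^ 2 = t ^ 2 * ∑ i, r i ^ 2 := by
    simp only [mul_pow, Finset.mul_sum]
  have hfit : ∑ i, (r i - h (x i)) ^ 2 = (1 - t) ^ 2 * ∑ i, r i ^ 2 := by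
    rw [Finset.mul_sum]
    exact Finset.sum_congr rfl fun i _ => by rw [hhx]; ring
  rw [hsum] at hR
  have hle : ENNReal.ofReal (∑ i, (r i - g (x i)) ^ 2) ≤
      ENNReal.ofReal ((1 - t) * ∑ i, r i ^ 2) :=
    calc ENNReal.ofReal (∑ i, (r i - g (x i)) ^ 2)
        ≤ criterion lam x r g := le_self_add
      _ ≤ criterion lam x r h := hg.2 h hh
      _ ≤ ENNReal.ofReal ((1 - t) ^ 2 * ∑ i, r i ^ 2) +
          ENNReal.ofReal lam * ENNReal.ofReal (C * (t ^ 2 * ∑ i, r i ^ 2)) := by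
        unfold criterion
        rw [hfit]
        gcongr
      _ = ENNReal.ofReal ((1 - t) * ∑ i, r i ^ 2) := by
        rw [← ENNReal.ofReal_mul hlam, ← ENNReal.ofReal_add (by positivity) (by positivity)]
        congr 1
        linear_combination (t * ∑ i, r i ^ 2) * ht1
  exact (ENNReal.ofReal_le_ofReal_iff (mul_nonneg (by linarith) hS)).1 hle

/-- A damped step with `ν ∈ [0, 1]` reduces the squared norm by the interpolated factor. -/
theorem rss_damped_step_le {n : ℕ} {r s : Fin n → ℝ} {c ν : ℝ} (hν₀ : 0 ≤ ν) (hν₁ : ν ≤ 1)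
    (h : ∑ i, (r i - s i) ^ 2 ≤ (1 - c) * ∑ i, r i ^ 2) :
    ∑ i, (r i - ν * s i) ^ 2 ≤ (1 - ν * c) * ∑ i, r i ^ 2 := by
  calc ∑ i, (r i - ν * s i) ^ 2
      ≤ ∑ i, ((1 - ν) * r i ^ 2 + ν * (r i - s i) ^ 2) :=
        Finset.sum_le_sum fun i _ => by
          -- The two sides differ by exactly `ν * (1 - ν) * s i ^ 2`.
          nlinarith [mul_nonneg (mul_nonneg hν₀ (sub_nonneg.2 hν₁)) (sq_nonneg (s i))]
    _ = (1 - ν) * ∑ i, r i ^ 2 + ν * ∑ i, (r i - s i) ^ 2 := by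
        rw [Finset.sum_add_distrib, Finset.mul_sum, Finset.mul_sum]
    _ ≤ (1 - ν * c) * ∑ i, r i ^ 2 := by
        linarith [mul_le_mul_of_nonneg_left h hν₀]

end CSSBoosting

/-- The fitted values of component-wise `L₂`-boosting with finitely many cubic smoothing splines
converge to those of the saturated model, which are the observations `y`, whatever sequence `sel`
of base learners is selected (greedy, cyclic, random, …). -/
theorem proposition3 {n p d : ℕ} (X : Matrix (Fin n) (Fin p) ℝ) (y : Fin n → ℝ)
    (feat : Fin d → Fin p) (lam : Fin d → ℝ) (ν : ℝ)
    (hlam : ∀ m, 0 ≤ lam m)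
    (hX : ∀ m, Function.Injective (fun i => X i (feat m)))
    (hν₀ : 0 < ν) (hν₁ : ν ≤ 1)
    (sel : ℕ → Fin d) (f : ℕ → (Fin p → ℝ) → ℝ)
    (hf : CSSBoosting.IsBoostingRun X y feat lam ν sel f) :
    Tendsto (fun (k : ℕ) (i : Fin n) => f k (X i)) atTop (𝓝 y) := by
  choose c hc0 hc1 hc using fun m => CSSBoosting.exists_rss_contraction (hX m) (hlam m)
  have : Nonempty (Fin d) := ⟨sel 0⟩
  -- The smallest gain `c m₀` is still positive, so one rate `q < 1` covers every selection.
  obtain ⟨m₀, hm₀⟩ := Finite.exists_min c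
  set q : ℝ := 1 - ν * c m₀ with hq
  have hνc : ν * c m₀ ≤ 1 := mul_le_one₀ hν₁ (hc0 m₀).le (hc1 m₀)
  have hq0 : 0 ≤ q := by linarith
  have hq1 : q < 1 := by linarith [mul_pos hν₀ (hc0 m₀)]
  have hstep : ∀ k, ∑ i, (y i - f (k + 1) (X i)) ^ 2 ≤ q * ∑ i, (y i - f k (X i)) ^ 2 := by
    intro k
    obtain ⟨g, hg, hfk⟩ := hf k
    have hS : 0 ≤ ∑ i, (y i - f k (X i)) ^ 2 := Finset.sum_nonneg fun i _ => sq_nonneg _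
    calc ∑ i, (y i - f (k + 1) (X i)) ^ 2
        = ∑ i, ((y i - f k (X i)) - ν * g (X i (feat (sel k)))) ^ 2 :=
          Finset.sum_congr rfl fun i _ => by rw [hfk]; ring
      _ ≤ (1 - ν * c (sel k)) * ∑ i, (y i - f k (X i)) ^ 2 :=
          CSSBoosting.rss_damped_step_le hν₀.le hν₁ (hc (sel k) _ g hg)
      _ ≤ q * ∑ i, (y i - f k (X i)) ^ 2 := by
          refine mul_le_mul_of_nonneg_right ?_ hS
          linarith [mul_le_mul_of_nonneg_left (hm₀ (sel k)) hν₀.le]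
  have hgeo : ∀ k, ∑ i, (y i - f k (X i)) ^ 2 ≤ q ^ k * ∑ i, (y i - f 0 (X i)) ^ 2 := by
    intro k
    induction k with
    | zero => simp
    | succ k ih =>
      calc _ ≤ q * ∑ i, (y i - f k (X i)) ^ 2 := hstep k
        _ ≤ q * (q ^ k * ∑ i, (y i - f 0 (X i)) ^ 2) := mul_le_mul_of_nonneg_left ih hq0
        _ = _ := by ring
  have hlim : Tendsto (fun k => q ^ k * ∑ i, (y i - f 0 (X i)) ^ 2) atTop (𝓝 0) := by
    simpa using (tendsto_pow_atTop_nhds_zero_of_lt_one hq0 hq1).mul_const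
      (∑ i, (y i - f 0 (X i)) ^ 2)
  refine tendsto_pi_nhds.2 fun i => ?_
  have hsq : Tendsto (fun k => (y i - f k (X i)) ^ 2) atTop (𝓝 0) :=
    squeeze_zero (fun k => sq_nonneg _) (fun k =>
      (Finset.single_le_sum (f := fun i => (y i - f k (X i)) ^ 2)
        (fun j _ => sq_nonneg _) (Finset.mem_univ i)).trans (hgeo k)) hlim
  have habs : Tendsto (fun k => |y i - f k (X i)|) atTop (𝓝 0) := by
    simpa [Real.sqrt_sq_eq_abs] using hsq.sqrt
  simpa using ((tendsto_zero_iff_abs_tendsto_zero _).2 habs).const_sub (y i)
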